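/- For $0<\alpha<1$ and $0<\beta<1$ and $t,\tau>0$ let $$f_\alpha(t,\tau)=\frac{1}{2\pi i}\int_{a-i\infty}^{a+i\infty}e^{z\tau-tz^\alpha}\,dz,\qquad \varphi_\beta(t,\tau)=\frac{1}{2\pi i}\int_{b-i\infty}^{b+i\infty}z^{\beta-1}e^{zt-\tau z^\beta}\,dz,$$ where $a,b>0$ are arbitrary and powers are principal branches, and let $f_1(t,\tau)=\varphi_1(t,\tau)=\delta(t-\tau)$ be the Dirac delta kernel. For $0<\alpha,\beta\le1$ define the subordination kernel $$\psi_{\alpha,\beta}(t,\tau)=\int_0^\infty\varphi_\beta(t,\sigma)\,f_\alpha(\sigma,\tau)\,d\sigma ,$$ so that $\psi_{\alpha,1}=f_\alpha$, $\psi_{1,\beta}=\varphi_\beta$ and $\psi_{1,1}(t,\tau)=\delta(t-\tau)$. **Proposition.** Let $0<\alpha,\beta\le1$, $a,b>0$ and $t>0$. Then all the integrals over vertical lines and over $(0,\infty)$ by which these kernels are defined (for those of the parameters that are smaller than $1$) converge absolutely for all $t,\tau>0$, and $\psi_{\alpha,\beta}(t,\cdot)$ is a unilateral probability density: if $(\alpha,\beta)\neq(1,1)$,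 then $\psi_{\alpha,\beta}(t,\tau)$ is real and $\ge0$ for every $\tau>0$, is integrable in $\tau$ over $(0,\infty)$, and $$\int_0^\infty\psi_{\alpha,\beta}(t,\tau)\,d\tau=1;$$ if $\alpha=\beta=1$, then $\psi_{1,1}(t,\cdot)$ is the unit point mass at $t$, a positive measure that gives $(0,\infty)$ mass $1$. -/

import Mathlib

open MeasureTheory

/-- The integrand `G(z) dz` along the vertical line `Re z = c`, upwards oriented and parametrized by
`z = c + i y`, so that `dz = i dy`. -/
noncomputable def verticalIntegrand (c : ℝ) (G : ℂ → ℂ) (y : ℝ) : ℂ :=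
  G ((c : ℂ) + (y : ℂ) * Complex.I) * Complex.I

/-- `(1 / (2 π i)) ∫_{c - i∞}^{c + i∞} G(z) dz`. -/
noncomputable def bromwich (c : ℝ) (G : ℂ → ℂ) : ℂ :=
  (1 / (2 * (Real.pi : ℂ) * Complex.I)) * ∫ y : ℝ, verticalIntegrand c G y

/-- `z ↦ exp (z τ - t z ^ α)`, with the principal branch of the power. -/
noncomputable def fIntegrand (α t τ : ℝ) (z : ℂ) : ℂ :=
  Complex.exp (z * (τ : ℂ) - (t : ℂ) * z ^ (α : ℂ))

/-- `z ↦ z ^ (β - 1) exp (z t - τ z ^ β)`, with the principal branch of the powers. -/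
noncomputable def phiIntegrand (β t τ : ℝ) (z : ℂ) : ℂ :=
  z ^ ((β : ℂ) - 1) * Complex.exp (z * (t : ℂ) - (τ : ℂ) * z ^ (β : ℂ))

/-- The function `f_α(t, τ)`, `0 < α < 1`, by its inverse Laplace integral along `Re z = c`. -/
noncomputable def fFun (α c t τ : ℝ) : ℂ := bromwich c (fIntegrand α t τ)

/-- The function `φ_β(t, τ)`, `0 < β < 1`, by its inverse Laplace integral along `Re z = c`. -/
noncomputable def phiFun (β c t τ : ℝ) : ℂ := bromwich c (phiIntegrand β t τ)

/-- A kernel in the variables `t, τ > 0`: the Dirac delta kernel `δ(t - τ)`,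
or an ordinary function `k(t, τ)`. -/
inductive SubKernel where
  | delta : SubKernel
  | density (k : ℝ → ℝ → ℂ) : SubKernel

namespace SubKernel

/-- The composition `∫₀^∞ K(t, σ) L(σ, τ) dσ`; the delta kernel is neutral on both sides. -/
noncomputable def comp : SubKernel → SubKernel → SubKernel
  | delta, L => L
  | density k, delta => density k
  | density k, density l => density fun t τ => ∫ s in Set.Ioi (0 : ℝ), k t s * l s τ

/-- `K(t, ·)` is a unilateral probability density: nonnegative (in particular real) at every `τ > 0`
and integrable over `(0, ∞)` with integral `1`. For the delta kernel, `δ(t - τ) dτ` is the point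
mass at `t`, which is a positive measure, and the claim is that it gives `(0, ∞)` mass `1`. -/
def IsUnilateralPdf : SubKernel → ℝ → Prop
  | delta, t => Measure.dirac t (Set.Ioi (0 : ℝ)) = 1
  | density k, t =>
      (∀ τ : ℝ, 0 < τ → (k t τ).im = 0 ∧ 0 ≤ (k t τ).re) ∧
      IntegrableOn (fun τ => k t τ) (Set.Ioi 0) ∧
      ∫ τ in Set.Ioi (0 : ℝ), k t τ = 1

end SubKernel

open Classical in
/-- The kernel `f_α`, `0 < α ≤ 1`, with `f_1(t, τ) = δ(t - τ)`. -/
noncomputable def fKernel (α c : ℝ) : SubKernel :=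
  if α = 1 then SubKernel.delta else SubKernel.density (fFun α c)

open Classical in
/-- The kernel `φ_β`, `0 < β ≤ 1`, with `φ_1(t, τ) = δ(t - τ)`. -/
noncomputable def phiKernel (β c : ℝ) : SubKernel :=
  if β = 1 then SubKernel.delta else SubKernel.density (phiFun β c)

/-- The subordination kernel `ψ_{α,β}(t, τ) = ∫₀^∞ φ_β(t, σ) f_α(σ, τ) dσ`, where `a` and `b` are
the abscissae of the lines of integration for `f_α` and `φ_β`. -/
noncomputable def psiKernel (α β a b : ℝ) : SubKernel :=
  (phiKernel β b).comp (fKernel α a)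

open Complex Filter Topology Set
open scoped ComplexOrder FourierTransform

/-! Everything reduces to showing that `f_α(s, ·)` is the one-sided stable density, with Laplace
transform `exp (-s z ^ α)`. On the right half-plane `Re z ^ α ≥ cos (α π / 2) ‖z‖ ^ α`, which gives
absolute convergence and, by Cauchy's theorem, independence of the abscissa.

Positivity (`fFun_nonneg`): `exp (-s (k (1 - w)) ^ α)` has nonnegative Taylor coefficients in `w`.
With `w = exp (-h z)` and `k = 1 / h` it becomes the Laplace transform of a positive measure on the
multiples of `h`, and it tends to `exp (-s z ^ α)` as `h → 0`. A Gaussian factor makes the inversion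
integrals converge and has a positive Fourier transform, so positivity survives the limit.

Mass (`lintegral_enorm_fFun`): Fourier inversion gives `∫ exp (-c τ) f_α(s, τ) dτ = exp (-s c ^ α)`;
letting `c → 0` gives mass `1`.

Integration by parts gives `τ f_α(s, τ) = s α φ_α(τ, s)` (`mul_fFun_eq_phiFun`), so `φ_β` inherits
positivity, and a power substitution transfers the mass. For the composition, positivity and Fubini
suffice. -/

/-- The point of height `y` on the vertical line `Re z = c`. -/
noncomputable def vline (c y : ℝ) : ℂ := (c : ℂ) + (y : ℂ) * I

/-- `exp (-s z ^ α)`, the Laplace transform of the one-sided stable law. -/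
noncomputable def stretchedExp (α s : ℝ) (z : ℂ) : ℂ := cexp (-((s : ℂ) * z ^ (α : ℂ)))

@[simp] lemma vline_re (c y : ℝ) : (vline c y).re = c := by simp [vline]

@[simp] lemma vline_im (c y : ℝ) : (vline c y).im = y := by simp [vline]

lemma abs_le_norm_vline (c y : ℝ) : |y| ≤ ‖vline c y‖ := by
  simpa using abs_im_le_norm (vline c y)

lemma le_norm_vline (c y : ℝ) : c ≤ ‖vline c y‖ := by
  simpa using re_le_norm (vline c y)

@[fun_prop] lemma continuous_vline (c : ℝ) : Continuous (vline c) := by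
  unfold vline; fun_prop

lemma hasDerivAt_vline (c y : ℝ) : HasDerivAt (vline c) I y := by
  have h : HasDerivAt (fun y : ℝ => (c : ℂ) + (y : ℂ) * I) (1 * I) y :=
    ((hasDerivAt_id y).ofReal_comp.mul_const I).const_add _
  unfold vline
  simpa using h

/-! ### Decay in the right half-plane and absolute convergence on vertical lines -/

lemma cos_sector_pos {α : ℝ} (h0 : 0 < α) (h1 : α < 1) : 0 < Real.cos (α * (Real.pi / 2)) := by
  apply Real.cos_pos_of_mem_Ioo
  constructor <;> nlinarith [Real.pi_pos]

/-- The real part is `‖z‖ ^ α cos (α arg z)` with `|arg z| ≤ π / 2`, and the cosine is smallest at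
the edge of the sector. -/
lemma norm_rpow_mul_cos_le_re_cpow {α : ℝ} (h0 : 0 < α) (h1 : α < 1) {z : ℂ} (hz : 0 < z.re) :
    ‖z‖ ^ α * Real.cos (α * (Real.pi / 2)) ≤ (z ^ (α : ℂ)).re := by
  rw [cpow_ofReal_re, ← Real.cos_abs (arg z * α), abs_mul, abs_of_pos h0, mul_comm |arg z|]
  have h := abs_arg_le_pi_div_two_iff.2 hz.le
  gcongr
  apply Real.cos_le_cos_of_nonneg_of_le_pi (by positivity) (by nlinarith [Real.pi_pos])
  gcongr

lemma norm_stretchedExp (α s : ℝ) (z : ℂ) :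
    ‖stretchedExp α s z‖ = Real.exp (-(s * (z ^ (α : ℂ)).re)) := by
  simp [stretchedExp, norm_exp]

lemma norm_stretchedExp_le {α s : ℝ} (h0 : 0 < α) (h1 : α < 1) (hs : 0 < s) {z : ℂ}
    (hz : 0 < z.re) :
    ‖stretchedExp α s z‖ ≤ Real.exp (-(s * Real.cos (α * (Real.pi / 2))) * ‖z‖ ^ α) := by
  rw [norm_stretchedExp]
  gcongr
  nlinarith [norm_rpow_mul_cos_le_re_cpow h0 h1 hz]

lemma norm_stretchedExp_le_one {α s : ℝ} (h0 : 0 < α) (h1 : α < 1) (hs : 0 < s) {z : ℂ}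
    (hz : 0 < z.re) : ‖stretchedExp α s z‖ ≤ 1 := by
  refine (norm_stretchedExp_le h0 h1 hs hz).trans ?_
  have := cos_sector_pos h0 h1
  rw [Real.exp_le_one_iff, neg_mul, neg_nonpos]
  positivity

lemma norm_stretchedExp_vline_le {α s : ℝ} (h0 : 0 < α) (h1 : α < 1) (hs : 0 < s) {c : ℝ}
    (hc : 0 < c) (y : ℝ) : ‖stretchedExp α s (vline c y)‖ ≤
      Real.exp (-(s * Real.cos (α * (Real.pi / 2))) * |y| ^ α) := by
  refine (norm_stretchedExp_le h0 h1 hs (by simpa)).trans ?_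
  have := cos_sector_pos h0 h1
  rw [neg_mul, neg_mul]
  gcongr
  exact abs_le_norm_vline c y

lemma integrable_exp_neg_mul_abs_rpow {p k : ℝ} (hp : 0 < p) (hk : 0 < k) :
    Integrable fun y : ℝ => Real.exp (-k * |y| ^ p) := by
  have h := integrableOn_rpow_mul_exp_neg_mul_rpow (p := p) (s := 0) (b := k) (by norm_num) hp hk
  have h' : IntegrableOn (fun y : ℝ => Real.exp (-k * y ^ p)) (Ioi 0) := by
    simpa using h
  have hpos : IntegrableOn (fun y : ℝ => Real.exp (-k * |y| ^ p)) (Ioi 0) :=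
    h'.congr_fun (fun y hy => by simp only [abs_of_pos (mem_Ioi.1 hy)]) measurableSet_Ioi
  have hneg : IntegrableOn (fun y : ℝ => Real.exp (-k * |y| ^ p)) (Iic 0) := by
    rw [← Measure.map_neg_eq_self (volume : Measure ℝ)]
    let m : MeasurableEmbedding fun x : ℝ => -x := (Homeomorph.neg ℝ).measurableEmbedding
    rw [m.integrableOn_map_iff]
    simp_rw [Function.comp_def, abs_neg, neg_preimage, neg_Iic, neg_zero]
    exact Iff.mpr integrableOn_Ici_iff_integrableOn_Ioi hpos
  rw [← integrableOn_univ, ← Iic_union_Ioi (a := (0 : ℝ))]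
  exact hneg.union hpos

lemma mem_slitPlane_of_re_pos {z : ℂ} (hz : 0 < z.re) : z ∈ slitPlane := Or.inl hz

lemma hasDerivAt_stretchedExp (α s : ℝ) {z : ℂ} (hz : 0 < z.re) :
    HasDerivAt (stretchedExp α s)
      (-((s : ℂ) * α * z ^ ((α : ℂ) - 1)) * stretchedExp α s z) z := by
  have h := (((hasDerivAt_id z).cpow_const (c := (α : ℂ))
    (mem_slitPlane_of_re_pos hz)).const_mul (s : ℂ)).neg.cexp
  refine HasDerivAt.congr_deriv (f := stretchedExp α s) h ?_
  simp only [stretchedExp, id_eq, mul_one, Pi.neg_apply]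
  ring

lemma continuous_stretchedExp_vline (α s : ℝ) {c : ℝ} (hc : 0 < c) :
    Continuous fun y => stretchedExp α s (vline c y) := by
  rw [continuous_iff_continuousAt]
  intro y
  exact (hasDerivAt_stretchedExp α s (by simpa)).continuousAt.comp
    (continuous_vline c).continuousAt

lemma continuous_cpow_vline (p : ℂ) {c : ℝ} (hc : 0 < c) :
    Continuous fun y => vline c y ^ p := by
  apply (continuous_vline c).cpow continuous_const
  intro y
  exact mem_slitPlane_of_re_pos (by simpa)

lemma integrable_stretchedExp_vline {α s : ℝ} (h0 : 0 < α) (h1 : α < 1) (hs : 0 < s) {c : ℝ}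
    (hc : 0 < c) : Integrable fun y => stretchedExp α s (vline c y) :=
  (integrable_exp_neg_mul_abs_rpow h0 (mul_pos hs (cos_sector_pos h0 h1))).mono'
    (continuous_stretchedExp_vline α s hc).aestronglyMeasurable
    (ae_of_all _ (norm_stretchedExp_vline_le h0 h1 hs hc))

lemma norm_cpow_le_rpow_of_re_pos {z : ℂ} (hz : 0 < z.re) (p : ℝ) : ‖z ^ (p : ℂ)‖ = ‖z‖ ^ p := by
  rw [norm_cpow_of_ne_zero (by rintro rfl; simp at hz)]
  simp

lemma norm_cpow_vline_le {p c : ℝ} (hp : p ≤ 0) (hc : 0 < c) (y : ℝ) :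
    ‖vline c y ^ (p : ℂ)‖ ≤ c ^ p := by
  rw [norm_cpow_le_rpow_of_re_pos (by simpa)]
  exact Real.rpow_le_rpow_of_nonpos hc (le_norm_vline c y) hp

lemma integrable_cpow_mul_stretchedExp_vline {α s p : ℝ} (h0 : 0 < α) (h1 : α < 1) (hs : 0 < s)
    (hp : p ≤ 0) {c : ℝ} (hc : 0 < c) :
    Integrable fun y => vline c y ^ (p : ℂ) * stretchedExp α s (vline c y) :=
  (integrable_stretchedExp_vline h0 h1 hs hc).bdd_mul (c := c ^ p)
    (continuous_cpow_vline _ hc).aestronglyMeasurable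
    (ae_of_all _ (norm_cpow_vline_le hp hc))

lemma norm_exp_vline_mul (c τ y : ℝ) : ‖cexp (vline c y * τ)‖ = Real.exp (c * τ) := by
  simp [norm_exp]

lemma MeasureTheory.Integrable.exp_vline_mul {u : ℝ → ℂ} (hu : Integrable u) (c τ : ℝ) :
    Integrable fun y => cexp (vline c y * τ) * u y :=
  hu.bdd_mul (c := Real.exp (c * τ)) (by fun_prop)
    (ae_of_all _ fun y => (norm_exp_vline_mul c τ y).le)

lemma verticalIntegrand_fIntegrand (α c s τ y : ℝ) :
    verticalIntegrand c (fIntegrand α s τ) y =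
      I * (cexp (vline c y * τ) * stretchedExp α s (vline c y)) := by
  simp only [verticalIntegrand, fIntegrand, stretchedExp, vline]
  rw [← Complex.exp_add, sub_eq_add_neg, mul_comm I]

lemma verticalIntegrand_phiIntegrand (β c t σ y : ℝ) :
    verticalIntegrand c (phiIntegrand β t σ) y =
      I * (cexp (vline c y * t) *
        (vline c y ^ ((β - 1 : ℝ) : ℂ) * stretchedExp β σ (vline c y))) := by
  simp only [verticalIntegrand, phiIntegrand, stretchedExp, vline]
  rw [sub_eq_add_neg (_ * (t : ℂ)), Complex.exp_add]
  push_cast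
  ring

lemma fFun_eq_integral (α c s τ : ℝ) :
    fFun α c s τ = (2 * Real.pi : ℂ)⁻¹ *
      ∫ y, cexp (vline c y * τ) * stretchedExp α s (vline c y) := by
  simp only [fFun, bromwich, verticalIntegrand_fIntegrand, integral_const_mul]
  rw [← mul_assoc]
  congr 1
  field_simp

lemma phiFun_eq_integral (β c t σ : ℝ) :
    phiFun β c t σ = (2 * Real.pi : ℂ)⁻¹ * ∫ y, cexp (vline c y * t) *
        (vline c y ^ ((β - 1 : ℝ) : ℂ) * stretchedExp β σ (vline c y)) := by
  simp only [phiFun, bromwich, verticalIntegrand_phiIntegrand, integral_const_mul]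
  rw [← mul_assoc]
  congr 1
  field_simp

lemma integrable_verticalIntegrand_fIntegrand {α s τ c : ℝ} (h0 : 0 < α) (h1 : α < 1)
    (hs : 0 < s) (hc : 0 < c) : Integrable (verticalIntegrand c (fIntegrand α s τ)) := by
  simp only [funext (verticalIntegrand_fIntegrand α c s τ)]
  exact ((integrable_stretchedExp_vline h0 h1 hs hc).exp_vline_mul c τ).const_mul I

lemma integrable_verticalIntegrand_phiIntegrand {β t σ c : ℝ} (h0 : 0 < β) (h1 : β < 1)
    (hσ : 0 < σ) (hc : 0 < c) : Integrable (verticalIntegrand c (phiIntegrand β t σ)) := by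
  simp only [funext (verticalIntegrand_phiIntegrand β c t σ)]
  exact ((integrable_cpow_mul_stretchedExp_vline h0 h1 hσ (by linarith) hc).exp_vline_mul
    c t).const_mul I

/-! ### Shifting the line of integration -/

/-- Cauchy's theorem on the rectangle with heights `-T` and `T`; `B T` bounds `G` on both horizontal
edges, which disappear as `T → ∞`. -/
lemma integral_vline_eq_of_le {G : ℂ → ℂ} (hG : ∀ z : ℂ, 0 < z.re → DifferentiableAt ℂ G z)
    {c d : ℝ} (hc : 0 < c) (hcd : c ≤ d) (hic : Integrable fun y => G (vline c y))
    (hid : Integrable fun y => G (vline d y)) {B : ℝ → ℝ}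
    (hB : ∀ x ∈ Icc c d, ∀ y : ℝ, ‖G (vline x y)‖ ≤ B |y|) (hB0 : Tendsto B atTop (𝓝 0)) :
    ∫ y, G (vline c y) = ∫ y, G (vline d y) := by
  have key : ∀ T : ℝ, (∫ y in (-T)..T, G (vline d y)) - (∫ y in (-T)..T, G (vline c y)) =
      -I * ((∫ x in c..d, G (vline x T)) - ∫ x in c..d, G (vline x (-T))) := by
    intro T
    have h := integral_boundary_rect_eq_zero_of_differentiableOn G (vline c (-T)) (vline d T) (by
      intro z hz
      apply (hG z _).differentiableWithinAt
      have h1 : z.re ∈ uIcc c d := by simpa using hz.1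
      rw [uIcc_of_le hcd] at h1
      linarith [h1.1])
    simp only [vline_re, vline_im, smul_eq_mul] at h
    simp only [vline]
    linear_combination -I * h + ((∫ y in (-T)..T, G (d + y * I)) -
      ∫ y in (-T)..T, G (c + y * I)) * I_sq
  have hlim : Tendsto (fun T : ℝ => (∫ y in (-T)..T, G (vline d y)) -
      ∫ y in (-T)..T, G (vline c y)) atTop
      (𝓝 ((∫ y, G (vline d y)) - ∫ y, G (vline c y))) :=
    (intervalIntegral_tendsto_integral hid tendsto_neg_atTop_atBot tendsto_id).sub
      (intervalIntegral_tendsto_integral hic tendsto_neg_atTop_atBot tendsto_id)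
  have hzero : Tendsto (fun T : ℝ => (∫ y in (-T)..T, G (vline d y)) -
      ∫ y in (-T)..T, G (vline c y)) atTop (𝓝 0) := by
    apply squeeze_zero_norm' (a := fun T => 2 * (d - c) * B T)
    · filter_upwards [eventually_ge_atTop 0] with T hT
      have hbd : ∀ y : ℝ, |y| = T → ‖∫ x in c..d, G (vline x y)‖ ≤ B T * (d - c) := by
        intro y hy
        have := intervalIntegral.norm_integral_le_of_norm_le_const (a := c) (b := d) (C := B T)
          (f := fun x => G (vline x y)) (fun x hx => by
            rw [uIoc_of_le hcd] at hx
            exact hy ▸ hB x (Ioc_subset_Icc_self hx) y)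
        rwa [abs_of_nonneg (sub_nonneg.2 hcd)] at this
      rw [key T, norm_mul, norm_neg, norm_I, one_mul]
      refine (norm_sub_le _ _).trans ?_
      linarith [hbd T (abs_of_nonneg hT), hbd (-T) (by rw [abs_neg, abs_of_nonneg hT])]
    · simpa using hB0.const_mul (2 * (d - c))
  exact (sub_eq_zero.1 (tendsto_nhds_unique hlim hzero)).symm

lemma tendsto_exp_neg_mul_rpow_atTop {α k : ℝ} (h0 : 0 < α) (hk : 0 < k) :
    Tendsto (fun y : ℝ => Real.exp (-k * y ^ α)) atTop (𝓝 0) := by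
  apply Real.tendsto_exp_atBot.comp
  exact (tendsto_rpow_atTop h0).const_mul_atTop_of_neg (by linarith)

lemma fFun_eq_of_le {α s c d : ℝ} (h0 : 0 < α) (h1 : α < 1) (hs : 0 < s) (hc : 0 < c)
    (hcd : c ≤ d) (τ : ℝ) : fFun α c s τ = fFun α d s τ := by
  rw [fFun_eq_integral, fFun_eq_integral]
  congr 1
  refine integral_vline_eq_of_le (G := fun z => cexp (z * τ) * stretchedExp α s z)
    (B := fun y => Real.exp (d * |τ|) *
      Real.exp (-(s * Real.cos (α * (Real.pi / 2))) * y ^ α)) ?_ hc hcd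
    ((integrable_stretchedExp_vline h0 h1 hs hc).exp_vline_mul c τ)
    ((integrable_stretchedExp_vline h0 h1 hs (hc.trans_le hcd)).exp_vline_mul d τ) ?_ ?_
  · intro z hz
    exact (by fun_prop : DifferentiableAt ℂ (fun z : ℂ => cexp (z * τ)) z).mul
      (hasDerivAt_stretchedExp α s hz).differentiableAt
  · intro x hx y
    rw [norm_mul, norm_exp_vline_mul]
    have hx0 : 0 < x := hc.trans_le hx.1
    have hxd : x ≤ d := hx.2
    have hxτ : x * τ ≤ d * |τ| := by
      calc x * τ ≤ x * |τ| := by gcongr; exact le_abs_self τ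
        _ ≤ d * |τ| := by gcongr
    exact mul_le_mul (Real.exp_le_exp.2 hxτ) (norm_stretchedExp_vline_le h0 h1 hs hx0 y)
      (norm_nonneg _) (Real.exp_pos _).le
  · simpa using (tendsto_exp_neg_mul_rpow_atTop h0
      (mul_pos hs (cos_sector_pos h0 h1))).const_mul (Real.exp (d * |τ|))

lemma fFun_abscissa {α s c d : ℝ} (h0 : 0 < α) (h1 : α < 1) (hs : 0 < s) (hc : 0 < c)
    (hd : 0 < d) (τ : ℝ) : fFun α c s τ = fFun α d s τ := by
  rcases le_total c d with h | h
  · exact fFun_eq_of_le h0 h1 hs hc h τ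
  · exact (fFun_eq_of_le h0 h1 hs hd h τ).symm

lemma norm_inv_two_pi_mul (x : ℂ) : ‖(2 * Real.pi : ℂ)⁻¹ * x‖ = (2 * Real.pi)⁻¹ * ‖x‖ := by
  simp [abs_of_pos Real.pi_pos]

lemma norm_fFun_le {α s c : ℝ} (h0 : 0 < α) (h1 : α < 1) (hs : 0 < s) (hc : 0 < c) (τ : ℝ) :
    ‖fFun α c s τ‖ ≤ Real.exp (c * τ) * ((2 * Real.pi)⁻¹ *
      ∫ y : ℝ, Real.exp (-(s * Real.cos (α * (Real.pi / 2))) * |y| ^ α)) := by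
  have hk := mul_pos hs (cos_sector_pos h0 h1)
  rw [fFun_eq_integral, norm_inv_two_pi_mul, mul_left_comm, ← integral_const_mul]
  gcongr
  refine norm_integral_le_of_norm_le ((integrable_exp_neg_mul_abs_rpow h0 hk).const_mul _)
    (ae_of_all _ fun y => ?_)
  rw [norm_mul, norm_exp_vline_mul]
  gcongr
  exact norm_stretchedExp_vline_le h0 h1 hs hc y

/-- Push the abscissa `d` to `+∞`: the bound is `exp (d τ)` times a constant independent of `d`. -/
lemma fFun_of_neg {α s c τ : ℝ} (h0 : 0 < α) (h1 : α < 1) (hs : 0 < s) (hc : 0 < c)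
    (hτ : τ < 0) : fFun α c s τ = 0 := by
  set K := (2 * Real.pi)⁻¹ *
      ∫ y : ℝ, Real.exp (-(s * Real.cos (α * (Real.pi / 2))) * |y| ^ α)
  have hlim : Tendsto (fun d : ℝ => Real.exp (d * τ) * K) atTop (𝓝 0) := by
    have : Tendsto (fun d : ℝ => Real.exp (d * τ)) atTop (𝓝 0) :=
      Real.tendsto_exp_atBot.comp (tendsto_id.atTop_mul_const_of_neg hτ)
    simpa using this.mul_const K
  rw [← norm_le_zero_iff]
  refine ge_of_tendsto hlim ?_
  filter_upwards [eventually_gt_atTop 0] with d hd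
  rw [fFun_abscissa h0 h1 hs hc hd]
  exact norm_fFun_le h0 h1 hs hd τ

/-! ### Integration by parts along the line -/

/-- Along the line `d/dy = I d/dz`, so `u'` plays the role of the complex derivative. Integrability
makes the boundary terms vanish. -/
lemma mul_integral_exp_vline_mul {u u' : ℝ → ℂ} (hu : ∀ y, HasDerivAt u (I * u' y) y)
    (hi : Integrable u) (hi' : Integrable u') (c τ : ℝ) :
    τ * ∫ y, cexp (vline c y * τ) * u y = -∫ y, cexp (vline c y * τ) * u' y := by
  have hv : ∀ y, HasDerivAt (fun y => cexp (vline c y * τ))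
      (cexp (vline c y * τ) * (I * τ)) y := fun y => ((hasDerivAt_vline c y).mul_const _).cexp
  have h := integral_mul_deriv_eq_deriv_mul_of_integrable (u := u) (u' := fun y => I * u' y)
    (v := fun y => cexp (vline c y * τ)) (v' := fun y => cexp (vline c y * τ) * (I * τ))
    (fun y _ => hu y) (fun y _ => hv y)
    (((hi.exp_vline_mul c τ).const_mul (I * τ)).congr (ae_of_all _ fun y => by
      simp only [Pi.mul_apply]; ring))
    (((hi'.exp_vline_mul c τ).const_mul I).congr (ae_of_all _ fun y => by
      simp only [Pi.mul_apply]; ring))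
    ((hi.exp_vline_mul c τ).congr (ae_of_all _ fun y => by
      simp only [Pi.mul_apply]; ring))
  have e1 : ∀ y, u y * (cexp (vline c y * τ) * (I * τ)) =
      (I * τ) * (cexp (vline c y * τ) * u y) := fun y => by ring
  have e2 : ∀ y, I * u' y * cexp (vline c y * τ) = I * (cexp (vline c y * τ) * u' y) :=
    fun y => by ring
  simp only [e1, e2, integral_const_mul] at h
  apply mul_left_cancel₀ I_ne_zero
  linear_combination h

/-- The `z`-derivative of `exp (-s z ^ α)` produces exactly the factor `z ^ (α - 1)` of the `φ`
integrand. This is the bridge from `f` to `φ`. -/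
lemma mul_fFun_eq_phiFun {α s c : ℝ} (h0 : 0 < α) (h1 : α < 1) (hs : 0 < s) (hc : 0 < c)
    (τ : ℝ) : τ * fFun α c s τ = s * α * phiFun α c τ s := by
  have hu : ∀ y, HasDerivAt (fun y => stretchedExp α s (vline c y))
      (I * (-(s * α : ℂ) * (vline c y ^ ((α - 1 : ℝ) : ℂ) * stretchedExp α s (vline c y)))) y := by
    intro y
    refine ((hasDerivAt_stretchedExp α s (z := vline c y) (by simpa)).comp y
      (hasDerivAt_vline c y)).congr_deriv ?_
    push_cast
    ring
  have h := mul_integral_exp_vline_mul hu (integrable_stretchedExp_vline h0 h1 hs hc)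
    ((integrable_cpow_mul_stretchedExp_vline h0 h1 hs (by linarith : α - 1 ≤ 0) hc).const_mul _) c τ
  simp only [mul_left_comm _ (-(s * α : ℂ)), integral_const_mul] at h
  rw [fFun_eq_integral, phiFun_eq_integral]
  linear_combination (2 * Real.pi : ℂ)⁻¹ * h

lemma integrable_norm_vline_rpow {c r : ℝ} (hc : 0 < c) (hr : 1 < r) :
    Integrable fun y => ‖vline c y‖ ^ (-r) := by
  -- The constant comes from `‖c + i y‖ ≥ c / (1 + c) * (1 + |y|)`.
  have h := (integrable_one_add_norm (E := ℝ) (r := r) (μ := volume) (by simpa)).const_mul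
    ((c / (1 + c)) ^ (-r))
  refine h.mono' ?_ (ae_of_all _ fun y => ?_)
  · apply Continuous.aestronglyMeasurable
    apply (continuous_vline c).norm.rpow_const
    intro y
    exact Or.inl (hc.trans_le (le_norm_vline c y)).ne'
  · rw [Real.norm_of_nonneg (by positivity), ← Real.mul_rpow (by positivity) (by positivity)]
    apply Real.rpow_le_rpow_of_nonpos (by positivity) _ (by linarith)
    rw [div_mul_eq_mul_div, div_le_iff₀ (by positivity), Real.norm_eq_abs]
    nlinarith [abs_le_norm_vline c y, le_norm_vline c y]

/-- A bound for `f_α(s, τ)` that is linear in `s`, obtained by integrating by parts twice. -/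
lemma exists_norm_fFun_le_mul_div_sq {α c : ℝ} (h0 : 0 < α) (h1 : α < 1) (hc : 0 < c) :
    ∃ K : ℝ, 0 ≤ K ∧ ∀ s τ : ℝ, 0 < s → τ ^ 2 * ‖fFun α c s τ‖ ≤ K * s * Real.exp (c * τ) := by
  set κ := Real.cos (α * (Real.pi / 2)) with hκ
  have hκ0 : 0 < κ := cos_sector_pos h0 h1
  set J := ∫ y, ‖vline c y‖ ^ (-(2 - α)) with hJ
  have hJi := integrable_norm_vline_rpow hc (show 1 < 2 - α by linarith)
  refine ⟨(2 * Real.pi)⁻¹ * ((1 + κ⁻¹) * J), by positivity, fun s τ hs => ?_⟩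
  set w : ℝ → ℂ := fun y => (((α - 1 : ℝ) : ℂ) * vline c y ^ ((α - 2 : ℝ) : ℂ) -
    s * α * (vline c y ^ ((α - 1 : ℝ) : ℂ) * vline c y ^ ((α - 1 : ℝ) : ℂ))) *
      stretchedExp α s (vline c y) with hw
  have hu : ∀ y, HasDerivAt (fun y => vline c y ^ ((α - 1 : ℝ) : ℂ) * stretchedExp α s (vline c y))
      (I * w y) y := by
    intro y
    have hz : 0 < (vline c y).re := by simpa
    refine ((((hasDerivAt_id (vline c y)).cpow_const (c := ((α - 1 : ℝ) : ℂ))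
      (mem_slitPlane_of_re_pos hz)).mul (hasDerivAt_stretchedExp α s hz)).comp y
      (hasDerivAt_vline c y)).congr_deriv ?_
    simp only [hw, id_eq]
    push_cast
    rw [show (α : ℂ) - 1 - 1 = α - 2 by ring]
    ring
  -- The bound must not depend on `s`: the excess factor `x = s ‖z‖ ^ α` of the second term is
  -- absorbed by the exponential through `x exp (-κ x) ≤ 1 / κ`.
  have hwb : ∀ y, ‖w y‖ ≤ (1 + κ⁻¹) * ‖vline c y‖ ^ (-(2 - α)) := by
    intro y
    have hz : 0 < (vline c y).re := by simpa
    have hn : 0 < ‖vline c y‖ := hc.trans_le (le_norm_vline c y)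
    set r := ‖vline c y‖ with hr
    set x := s * r ^ α with hx
    have hx0 : 0 < x := by positivity
    have hE : ‖stretchedExp α s (vline c y)‖ ≤ Real.exp (-(κ * x)) := by
      refine (norm_stretchedExp_le h0 h1 hs hz).trans (le_of_eq ?_)
      congr 1
      rw [hx]; ring
    have hxE : x * Real.exp (-(κ * x)) ≤ κ⁻¹ := by
      rw [Real.exp_neg, ← div_eq_mul_inv, div_le_iff₀ (Real.exp_pos _), inv_mul_eq_div,
        le_div_iff₀ hκ0]
      linarith [Real.add_one_le_exp (κ * x)]
    have hE1 : Real.exp (-(κ * x)) ≤ 1 := by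
      rw [Real.exp_le_one_iff, neg_nonpos]; positivity
    have hpow : s * (r ^ (α - 1) * r ^ (α - 1)) = x * r ^ (-(2 - α)) := by
      rw [hx, mul_assoc, ← Real.rpow_add hn, ← Real.rpow_add hn]
      congr 2; ring
    have hfac : ‖((α - 1 : ℝ) : ℂ) * vline c y ^ ((α - 2 : ℝ) : ℂ) -
        s * α * (vline c y ^ ((α - 1 : ℝ) : ℂ) * vline c y ^ ((α - 1 : ℝ) : ℂ))‖ ≤
        (1 + x) * r ^ (-(2 - α)) := by
      refine (norm_sub_le _ _).trans ?_
      simp only [norm_mul, norm_cpow_le_rpow_of_re_pos hz, norm_real, Real.norm_eq_abs]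
      rw [← hr, abs_of_pos hs, abs_of_pos h0, abs_of_neg (by linarith : α - 1 < 0),
        show α - 2 = -(2 - α) by ring]
      have hp : 0 < r ^ (-(2 - α)) := by positivity
      have : s * α * (r ^ (α - 1) * r ^ (α - 1)) ≤ x * r ^ (-(2 - α)) := by
        rw [← hpow]
        have : 0 ≤ s * (r ^ (α - 1) * r ^ (α - 1)) := by positivity
        nlinarith
      nlinarith
    rw [hw]
    simp only [norm_mul]
    calc _ ≤ (1 + x) * r ^ (-(2 - α)) * Real.exp (-(κ * x)) := by gcongr
      _ = (Real.exp (-(κ * x)) + x * Real.exp (-(κ * x))) * r ^ (-(2 - α)) := by ring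
      _ ≤ _ := by gcongr
  have hwc : Continuous w := by
    have := continuous_stretchedExp_vline α s hc
    have := continuous_cpow_vline ((α - 2 : ℝ) : ℂ) hc
    have := continuous_cpow_vline ((α - 1 : ℝ) : ℂ) hc
    fun_prop
  have hwi : Integrable w := (hJi.const_mul (1 + κ⁻¹)).mono' hwc.aestronglyMeasurable
    (ae_of_all _ hwb)
  have h := mul_integral_exp_vline_mul hu
    (integrable_cpow_mul_stretchedExp_vline h0 h1 hs (by linarith : α - 1 ≤ 0) hc) hwi c τ
  have h2 : (τ : ℂ) ^ 2 * fFun α c s τ = -(s * α) * ((2 * Real.pi : ℂ)⁻¹ *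
      ∫ y, cexp (vline c y * τ) * w y) := by
    have h3 := mul_fFun_eq_phiFun h0 h1 hs hc τ
    rw [phiFun_eq_integral] at h3
    linear_combination τ * h3 + s * α * (2 * Real.pi : ℂ)⁻¹ * h
  have hint : ‖∫ y, cexp (vline c y * τ) * w y‖ ≤ Real.exp (c * τ) * ((1 + κ⁻¹) * J) := by
    rw [hJ, ← integral_const_mul, ← integral_const_mul]
    refine norm_integral_le_of_norm_le ((hJi.const_mul _).const_mul _) (ae_of_all _ fun y => ?_)
    rw [norm_mul, norm_exp_vline_mul]
    gcongr
    exact hwb y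
  calc τ ^ 2 * ‖fFun α c s τ‖ = ‖(τ : ℂ) ^ 2 * fFun α c s τ‖ := by simp
    _ = s * α * ((2 * Real.pi)⁻¹ * ‖∫ y, cexp (vline c y * τ) * w y‖) := by
      rw [h2, norm_mul, norm_inv_two_pi_mul]
      simp [abs_of_pos hs, abs_of_pos h0]
    _ ≤ s * 1 * ((2 * Real.pi)⁻¹ * (Real.exp (c * τ) * ((1 + κ⁻¹) * J))) := by gcongr
    _ = _ := by ring

/-! ### Self-similarity of `f_α` -/

lemma real_mul_cpow {k : ℝ} (hk : 0 < k) {z : ℂ} (hz : z ≠ 0) (p : ℂ) :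
    ((k : ℂ) * z) ^ p = (k : ℂ) ^ p * z ^ p := by
  have hk' : (k : ℂ) ≠ 0 := ofReal_ne_zero.2 hk.ne'
  rw [cpow_def_of_ne_zero (mul_ne_zero hk' hz), cpow_def_of_ne_zero hk', cpow_def_of_ne_zero hz,
    log_ofReal_mul hk hz, ← Complex.exp_add, ofReal_log hk.le]
  ring_nf

lemma fFun_scaling {α s c k : ℝ} (hc : 0 < c) (hk : 0 < k) (τ : ℝ) :
    fFun α c s τ = k * fFun α (c / k) (s * k ^ α) (k * τ) := by
  rw [fFun_eq_integral, fFun_eq_integral]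
  have h := Measure.integral_comp_mul_left
    (fun y => cexp (vline c y * τ) * stretchedExp α s (vline c y)) k
  have e : ∀ y, vline c (k * y) = k * vline (c / k) y := by
    intro y
    simp only [vline]
    push_cast
    have : (k : ℂ) ≠ 0 := ofReal_ne_zero.2 hk.ne'
    field_simp
  have hne : ∀ y, vline (c / k) y ≠ 0 := fun y => by
    rw [← norm_pos_iff]
    exact (div_pos hc hk).trans_le (le_norm_vline _ _)
  have e2 : ∀ y, cexp (vline c (k * y) * τ) * stretchedExp α s (vline c (k * y)) =
      cexp (vline (c / k) y * (k * τ : ℝ)) * stretchedExp α (s * k ^ α) (vline (c / k) y) := by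
    intro y
    simp only [e, stretchedExp, real_mul_cpow hk (hne y)]
    push_cast [ofReal_cpow hk.le]
    ring_nf
  simp only [e2] at h
  rw [h, abs_of_pos (inv_pos.2 hk), real_smul]
  have : (k : ℂ) ≠ 0 := ofReal_ne_zero.2 hk.ne'
  rw [ofReal_inv]
  set J := ∫ y, cexp (vline c y * τ) * stretchedExp α s (vline c y)
  field_simp

lemma fFun_eq_fFun_one {α s c : ℝ} (h0 : 0 < α) (h1 : α < 1) (hs : 0 < s) (hc : 0 < c) (τ : ℝ) :
    fFun α c s τ = (s ^ (-α⁻¹) : ℝ) * fFun α c 1 (s ^ (-α⁻¹) * τ) := by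
  -- This dilation factor `k` solves `s * k ^ α = 1`.
  have hk : 0 < s ^ (-α⁻¹) := by positivity
  rw [fFun_scaling hc hk, ← Real.rpow_mul hs.le, neg_mul, inv_mul_cancel₀ h0.ne',
    Real.rpow_neg_one, mul_inv_cancel₀ hs.ne',
    fFun_abscissa h0 h1 one_pos (div_pos hc hk) hc]

/-! ### Nonnegative Taylor coefficients -/

lemma re_real_mul_one_sub_pos {k : ℝ} (hk : 0 < k) {w : ℂ} (hw : w ∈ Metric.ball (0 : ℂ) 1) :
    0 < ((k : ℂ) * (1 - w)).re := by
  have h1 : w.re < 1 := (re_le_norm w).trans_lt (by simpa using hw)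
  simpa using mul_pos hk (sub_pos.2 h1)

lemma hasDerivAt_real_mul_one_sub (k : ℝ) (w : ℂ) :
    HasDerivAt (fun w : ℂ => (k : ℂ) * (1 - w)) (-k) w := by
  simpa using ((hasDerivAt_id w).const_sub 1).const_mul (k : ℂ)

lemma hasDerivAt_cpow_real_mul_one_sub {k : ℝ} (hk : 0 < k) (p : ℝ) {w : ℂ}
    (hw : w ∈ Metric.ball (0 : ℂ) 1) :
    HasDerivAt (fun w : ℂ => ((k : ℂ) * (1 - w)) ^ (p : ℂ))
      ((-p * k : ℝ) * ((k : ℂ) * (1 - w)) ^ ((p - 1 : ℝ) : ℂ)) w := by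
  refine ((hasDerivAt_real_mul_one_sub k w).cpow_const (c := (p : ℂ))
    (mem_slitPlane_of_re_pos (re_real_mul_one_sub_pos hk hw))).congr_deriv ?_
  push_cast
  ring

/-- Differentiation yields the factor `-p k ≥ 0` and lowers `p` by one, so the induction has to
range over all `p ≤ 0`. -/
lemma iteratedDeriv_cpow_nonneg {k : ℝ} (hk : 0 < k) (n : ℕ) :
    ∀ p : ℝ, p ≤ 0 → 0 ≤ iteratedDeriv n (fun w : ℂ => ((k : ℂ) * (1 - w)) ^ (p : ℂ)) 0 := by
  induction n with
  | zero =>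
    intro p _
    simp only [iteratedDeriv_zero, sub_zero, mul_one]
    rw [← ofReal_cpow hk.le]
    exact_mod_cast (Real.rpow_pos_of_pos hk p).le
  | succ n ih =>
    intro p hp
    have he : deriv (fun w : ℂ => ((k : ℂ) * (1 - w)) ^ (p : ℂ)) =ᶠ[𝓝 0]
        fun w => ((-p * k : ℝ) : ℂ) * ((k : ℂ) * (1 - w)) ^ ((p - 1 : ℝ) : ℂ) := by
      filter_upwards [Metric.ball_mem_nhds (0 : ℂ) one_pos] with w hw
      exact (hasDerivAt_cpow_real_mul_one_sub hk p hw).deriv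
    rw [iteratedDeriv_succ', he.iteratedDeriv_eq, iteratedDeriv_const_mul_field]
    refine mul_nonneg ?_ (ih (p - 1) (by linarith))
    exact_mod_cast mul_nonneg (neg_nonneg.2 hp) hk.le

lemma hasDerivAt_stretchedExp_real_mul_one_sub (α s : ℝ) {k : ℝ} (hk : 0 < k) {w : ℂ}
    (hw : w ∈ Metric.ball (0 : ℂ) 1) :
    HasDerivAt (fun w : ℂ => stretchedExp α s (k * (1 - w)))
      ((s * α * k : ℝ) * (((k : ℂ) * (1 - w)) ^ ((α - 1 : ℝ) : ℂ) *
        stretchedExp α s (k * (1 - w)))) w := by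
  refine ((hasDerivAt_stretchedExp α s (re_real_mul_one_sub_pos hk hw)).comp w
    (hasDerivAt_real_mul_one_sub k w)).congr_deriv ?_
  push_cast
  ring

lemma contDiffAt_of_hasDerivAt_ball {f f' : ℂ → ℂ}
    (h : ∀ w ∈ Metric.ball (0 : ℂ) 1, HasDerivAt f (f' w) w) (n : ℕ) : ContDiffAt ℂ n f 0 := by
  have hd : DifferentiableOn ℂ f (Metric.ball 0 1) := fun w hw =>
    (h w hw).differentiableAt.differentiableWithinAt
  exact (hd.analyticAt (Metric.ball_mem_nhds _ one_pos)).contDiffAt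

/-- The derivative is a positive multiple of `(k (1 - w)) ^ (α - 1)` times the function itself. As
`α - 1 < 0`, the Leibniz rule expresses each derivative through lower ones with nonnegative
coefficients. -/
lemma iteratedDeriv_stretchedExp_nonneg {α s k : ℝ} (h0 : 0 < α) (h1 : α < 1) (hs : 0 < s)
    (hk : 0 < k) (n : ℕ) :
    0 ≤ iteratedDeriv n (fun w : ℂ => stretchedExp α s (k * (1 - w))) 0 := by
  induction n using Nat.strong_induction_on with
  | _ n ih =>
  rcases n with _ | n
  · simp only [iteratedDeriv_zero, sub_zero, mul_one, stretchedExp]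
    rw [← ofReal_cpow hk.le]
    exact_mod_cast (Real.exp_pos _).le
  · have he : deriv (fun w : ℂ => stretchedExp α s (k * (1 - w))) =ᶠ[𝓝 0]
        fun w => ((s * α * k : ℝ) : ℂ) * (((k : ℂ) * (1 - w)) ^ ((α - 1 : ℝ) : ℂ) *
          stretchedExp α s (k * (1 - w))) := by
      filter_upwards [Metric.ball_mem_nhds (0 : ℂ) one_pos] with w hw
      exact (hasDerivAt_stretchedExp_real_mul_one_sub α s hk hw).deriv
    rw [iteratedDeriv_succ', he.iteratedDeriv_eq, iteratedDeriv_const_mul_field,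
      iteratedDeriv_fun_mul
        (contDiffAt_of_hasDerivAt_ball
          (fun w hw => hasDerivAt_cpow_real_mul_one_sub hk (α - 1) hw) n)
        (contDiffAt_of_hasDerivAt_ball
          (fun w hw => hasDerivAt_stretchedExp_real_mul_one_sub α s hk hw) n)]
    refine mul_nonneg (by exact_mod_cast (by positivity : 0 ≤ s * α * k))
      (Finset.sum_nonneg fun i hi => mul_nonneg (mul_nonneg (by positivity) ?_) ?_)
    · exact iteratedDeriv_cpow_nonneg hk i (α - 1) (by linarith)
    · exact ih (n - i) (by omega)

/-- `w ↦ exp (-s (k (1 - w)) ^ α)` has a power series with nonnegative coefficients. -/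
lemma exists_hasSum_stretchedExp {α s k : ℝ} (h0 : 0 < α) (h1 : α < 1) (hs : 0 < s)
    (hk : 0 < k) : ∃ q : ℕ → ℝ, (∀ n, 0 ≤ q n) ∧ ∀ w ∈ Metric.ball (0 : ℂ) 1,
      HasSum (fun n => (q n : ℂ) * w ^ n) (stretchedExp α s (k * (1 - w))) := by
  set F : ℂ → ℂ := fun w => stretchedExp α s (k * (1 - w))
  have hq := fun n => Complex.nonneg_iff.1 (iteratedDeriv_stretchedExp_nonneg h0 h1 hs hk n)
  have hd : DifferentiableOn ℂ F (Metric.ball 0 1) := fun w hw =>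
    (hasDerivAt_stretchedExp_real_mul_one_sub α s hk hw).differentiableAt.differentiableWithinAt
  refine ⟨fun n => (n.factorial : ℝ)⁻¹ * (iteratedDeriv n F 0).re,
    fun n => mul_nonneg (by positivity) (hq n).1, fun w hw => ?_⟩
  have h := hasSum_taylorSeries_on_ball hd hw
  refine h.congr_fun fun n => ?_
  have : ((iteratedDeriv n F 0).re : ℂ) = iteratedDeriv n F 0 :=
    Complex.ext (by simp) (by simpa using (hq n).2)
  push_cast
  rw [this, smul_eq_mul, smul_eq_mul, sub_zero]
  ring

/-! ### Positivity of `f_α` -/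

lemma fourierIntegral_gaussian_nonneg {b : ℝ} (hb : 0 < b) (x : ℝ) :
    0 ≤ ∫ y : ℝ, cexp (I * x * y) * cexp (-b * y ^ 2) := by
  rw [fourierIntegral_gaussian (by simpa)]
  have h : ((Real.pi : ℂ) / b) ^ (1 / 2 : ℂ) * cexp (-(x : ℂ) ^ 2 / (4 * b)) =
      (((Real.pi / b) ^ (1 / 2 : ℝ) * Real.exp (-x ^ 2 / (4 * b)) : ℝ) : ℂ) := by
    push_cast [ofReal_cpow (div_pos Real.pi_pos hb).le]
    rfl
  rw [h]
  exact_mod_cast (by positivity)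

lemma norm_exp_I_mul (τ y : ℝ) : ‖cexp (I * τ * y)‖ = 1 := by
  rw [norm_exp]; simp

lemma exp_neg_mul_vline_mem_ball {h c : ℝ} (hh : 0 < h) (hc : 0 < c) (y : ℝ) :
    cexp (-(h * vline c y)) ∈ Metric.ball (0 : ℂ) 1 := by
  simpa [norm_exp] using mul_pos hh hc

/-- Expanding in powers of `exp (-h z)` turns the integral into a nonnegative combination of
Gaussian Fourier integrals at the frequencies `τ - h n`. The Gaussian is needed because the
individual terms do not decay along the line. -/
lemma integral_gaussian_mul_stretchedExp_approx_nonneg {α s h b c : ℝ} (h0 : 0 < α) (h1 : α < 1)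
    (hs : 0 < s) (hh : 0 < h) (hb : 0 < b) (hc : 0 < c) (τ : ℝ) :
    0 ≤ ∫ y : ℝ, cexp (-b * y ^ 2) * (cexp (I * τ * y) *
      stretchedExp α s ((h⁻¹ : ℝ) * (1 - cexp (-(h * vline c y))))) := by
  obtain ⟨q, hq0, hq⟩ := exists_hasSum_stretchedExp h0 h1 hs (inv_pos.2 hh)
  set g : ℕ → ℝ → ℂ := fun n y => ((q n * Real.exp (-(h * c)) ^ n : ℝ) : ℂ) *
    (cexp (I * (τ - h * n : ℝ) * y) * cexp (-b * y ^ 2)) with hg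
  have hsum : ∀ y : ℝ, HasSum (fun n => g n y) (cexp (-b * y ^ 2) * (cexp (I * τ * y) *
      stretchedExp α s ((h⁻¹ : ℝ) * (1 - cexp (-(h * vline c y)))))) := by
    intro y
    have := ((hq _ (exp_neg_mul_vline_mem_ball hh hc y)).mul_left
      (cexp (I * τ * y))).mul_left (cexp (-b * y ^ 2))
    refine this.congr_fun fun n => ?_
    have e : ((Real.exp (-(h * c)) : ℝ) : ℂ) ^ n * cexp (I * (τ - h * n : ℝ) * y) =
        cexp (I * τ * y) * cexp (-(h * vline c y)) ^ n := by
      rw [ofReal_exp, ← Complex.exp_nat_mul, ← Complex.exp_nat_mul, ← Complex.exp_add,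
        ← Complex.exp_add]
      simp only [vline]
      push_cast
      ring_nf
    simp only [hg]
    rw [ofReal_mul, ofReal_pow]
    linear_combination (q n : ℂ) * cexp (-b * y ^ 2) * e
  have hgauss : Integrable fun y : ℝ => Real.exp (-b * y ^ 2) := integrable_exp_neg_mul_sq hb
  have hnorm : ∀ n y, ‖g n y‖ = q n * Real.exp (-(h * c)) ^ n * Real.exp (-b * y ^ 2) := by
    intro n y
    have e2 : ‖cexp (-b * y ^ 2)‖ = Real.exp (-b * y ^ 2) := by
      rw [norm_exp]; congr 1; norm_cast
    have e3 : 0 ≤ q n * Real.exp (-(h * c)) ^ n := mul_nonneg (hq0 n) (by positivity)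
    simp only [hg, norm_mul, norm_exp_I_mul, e2, norm_real, Real.norm_of_nonneg e3, one_mul]
  have hgi : ∀ n, Integrable (g n) := by
    intro n
    refine Integrable.mono' (hgauss.const_mul (q n * Real.exp (-(h * c)) ^ n)) ?_
      (ae_of_all _ fun y => (hnorm n y).le)
    apply Continuous.aestronglyMeasurable
    simp only [hg]
    fun_prop
  have hqs : Summable fun n => q n * Real.exp (-(h * c)) ^ n := by
    -- At height `0` the point `w = exp (-h c)` is positive, so the power series there is the
    -- required majorant.
    have := (hq _ (exp_neg_mul_vline_mem_ball hh hc 0)).summable.norm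
    refine this.congr fun n => ?_
    rw [norm_mul, norm_pow, norm_real, Real.norm_of_nonneg (hq0 n), norm_exp]
    simp
  have hS := hasSum_integral_of_summable_integral_norm hgi (by
    simp only [hnorm, integral_const_mul]
    exact hqs.mul_right _)
  simp only [fun y => (hsum y).tsum_eq] at hS
  refine hS.nonneg fun n => ?_
  simp only [hg, integral_const_mul]
  refine mul_nonneg ?_ (fourierIntegral_gaussian_nonneg hb _)
  exact_mod_cast mul_nonneg (hq0 n) (by positivity)

lemma tendsto_inv_mul_one_sub_exp (z : ℂ) :
    Tendsto (fun h : ℝ => ((h⁻¹ : ℝ) : ℂ) * (1 - cexp (-(h * z)))) (𝓝[>] 0) (𝓝 z) := by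
  have hd : HasDerivAt (fun h : ℝ => 1 - cexp (-((h : ℂ) * z))) z 0 := by
    have := ((((hasDerivAt_id (0 : ℝ)).ofReal_comp.mul_const z).neg).cexp).const_sub 1
    simpa using! this
  simpa using! hd.tendsto_slope_zero_right

/-- Two limits in succession: `h → 0` under a fixed Gaussian of parameter `1 / r`, then `r → ∞` to
remove the Gaussian. -/
lemma integral_exp_mul_stretchedExp_nonneg {α s c : ℝ} (h0 : 0 < α) (h1 : α < 1)
    (hs : 0 < s) (hc : 0 < c) (τ : ℝ) :
    0 ≤ ∫ y : ℝ, cexp (I * τ * y) * stretchedExp α s (vline c y) := by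
  have hint : Integrable fun y : ℝ => cexp (I * τ * y) * stretchedExp α s (vline c y) :=
    (integrable_stretchedExp_vline h0 h1 hs hc).bdd_mul (c := 1) (by fun_prop)
      (ae_of_all _ fun y => (norm_exp_I_mul τ y).le)
  have hlim := Real.tendsto_integral_cexp_sq_smul hint
  refine ge_of_tendsto hlim ?_
  filter_upwards [eventually_gt_atTop 0] with r hr
  have hb : 0 < r⁻¹ := inv_pos.2 hr
  have hlim2 : Tendsto (fun h : ℝ => ∫ y : ℝ, cexp (-(r⁻¹ : ℝ) * y ^ 2) * (cexp (I * τ * y) *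
      stretchedExp α s ((h⁻¹ : ℝ) * (1 - cexp (-(h * vline c y)))))) (𝓝[>] 0)
      (𝓝 (∫ y : ℝ, cexp (-(r⁻¹ : ℝ) * y ^ 2) *
        (cexp (I * τ * y) * stretchedExp α s (vline c y)))) := by
    refine tendsto_integral_filter_of_dominated_convergence
      (fun y => Real.exp (-r⁻¹ * y ^ 2)) ?_ ?_ (integrable_exp_neg_mul_sq hb) ?_
    · filter_upwards [self_mem_nhdsWithin] with h hh
      apply Continuous.aestronglyMeasurable
      have : Continuous fun y =>
          stretchedExp α s ((h⁻¹ : ℝ) * (1 - cexp (-(h * vline c y)))) := by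
        rw [continuous_iff_continuousAt]
        intro y
        exact (hasDerivAt_stretchedExp_real_mul_one_sub α s (inv_pos.2 hh)
          (exp_neg_mul_vline_mem_ball hh hc y)).continuousAt.comp
          (f := fun y => cexp (-(h * vline c y))) (by fun_prop)
      fun_prop
    · filter_upwards [self_mem_nhdsWithin] with h hh
      refine ae_of_all _ fun y => ?_
      have e2 : ‖cexp (-(r⁻¹ : ℝ) * y ^ 2)‖ = Real.exp (-r⁻¹ * y ^ 2) := by
        rw [norm_exp]; congr 1; norm_cast
      -- The approximating point `(1 - exp (-h z)) / h` stays in the right half-plane, so the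
      -- Gaussian alone dominates.
      have e3 := norm_stretchedExp_le_one h0 h1 hs
        (re_real_mul_one_sub_pos (inv_pos.2 hh) (exp_neg_mul_vline_mem_ball hh hc y))
      rw [norm_mul, norm_mul, norm_exp_I_mul, e2, one_mul]
      exact mul_le_of_le_one_right (Real.exp_pos _).le e3
    · refine ae_of_all _ fun y => ?_
      refine Tendsto.const_mul _ (Tendsto.const_mul _ ?_)
      exact (hasDerivAt_stretchedExp α s (z := vline c y) (by simpa)).continuousAt.tendsto.comp
        (tendsto_inv_mul_one_sub_exp _)
  have hpos := ge_of_tendsto hlim2 (by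
    filter_upwards [self_mem_nhdsWithin] with h hh
    exact integral_gaussian_mul_stretchedExp_approx_nonneg h0 h1 hs hh hb hc τ)
  refine hpos.trans_eq (integral_congr_ae (ae_of_all _ fun y => ?_))
  simp only
  rw [smul_eq_mul, Real.norm_eq_abs, ← ofReal_pow |y|, sq_abs, ofReal_pow]

lemma fFun_eq_exp_mul_integral (α c s τ : ℝ) :
    fFun α c s τ = (Real.exp (c * τ) * (2 * Real.pi)⁻¹ : ℝ) *
      ∫ y : ℝ, cexp (I * τ * y) * stretchedExp α s (vline c y) := by
  have e : ∀ y : ℝ, cexp (vline c y * τ) * stretchedExp α s (vline c y) =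
      cexp (c * τ) * (cexp (I * τ * y) * stretchedExp α s (vline c y)) := by
    intro y
    rw [← mul_assoc, ← Complex.exp_add]
    simp only [vline]
    ring_nf
  simp only [fFun_eq_integral, e, integral_const_mul]
  push_cast
  ring

lemma fFun_nonneg {α s c : ℝ} (h0 : 0 < α) (h1 : α < 1) (hs : 0 < s) (hc : 0 < c) (τ : ℝ) :
    0 ≤ fFun α c s τ := by
  rw [fFun_eq_exp_mul_integral]
  refine mul_nonneg ?_ (integral_exp_mul_stretchedExp_nonneg h0 h1 hs hc τ)
  exact_mod_cast (by positivity)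

/-! ### Laplace transform and total mass of `f_α` -/

lemma continuous_fFun {α s c : ℝ} (h0 : 0 < α) (h1 : α < 1) (hs : 0 < s) (hc : 0 < c) :
    Continuous (fFun α c s) := by
  have h : Continuous fun τ : ℝ => ∫ y : ℝ, cexp (I * τ * y) * stretchedExp α s (vline c y) := by
    have hu := continuous_stretchedExp_vline α s hc
    refine continuous_of_dominated (bound := fun y => ‖stretchedExp α s (vline c y)‖)
      (fun τ => Continuous.aestronglyMeasurable (by fun_prop)) (fun τ => ae_of_all _ fun y => ?_)
      (integrable_stretchedExp_vline h0 h1 hs hc).norm (ae_of_all _ fun y => by fun_prop)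
    rw [norm_mul, norm_exp_I_mul, one_mul]
  rw [funext (fFun_eq_exp_mul_integral α c s)]
  fun_prop

/-- Adding the bound without a power of `τ` to the one with `τ ^ 2` gives the majorant `(M + K s) /
(1 + τ ^ 2)`. Fourier inversion needs this integrability. -/
lemma integrable_exp_neg_mul_fFun {α s c : ℝ} (h0 : 0 < α) (h1 : α < 1) (hs : 0 < s)
    (hc : 0 < c) : Integrable fun τ : ℝ => (Real.exp (-(c * τ)) : ℂ) * fFun α c s τ := by
  obtain ⟨K, hK0, hK⟩ := exists_norm_fFun_le_mul_div_sq h0 h1 hc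
  set M := (2 * Real.pi)⁻¹ *
      ∫ y : ℝ, Real.exp (-(s * Real.cos (α * (Real.pi / 2))) * |y| ^ α)
  have hf := continuous_fFun h0 h1 hs hc
  refine (integrable_inv_one_add_sq.const_mul (M + K * s)).mono'
    (Continuous.aestronglyMeasurable (by fun_prop)) (ae_of_all _ fun τ => ?_)
  rw [norm_mul, norm_real, Real.norm_of_nonneg (Real.exp_pos _).le, ← div_eq_mul_inv,
    le_div_iff₀ (by positivity)]
  have e : Real.exp (-(c * τ)) * Real.exp (c * τ) = 1 := by rw [← Real.exp_add]; simp
  have b1 := mul_le_mul_of_nonneg_left (norm_fFun_le h0 h1 hs hc τ) (Real.exp_pos (-(c * τ))).le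
  have b2 := mul_le_mul_of_nonneg_left (hK s τ hs) (Real.exp_pos (-(c * τ))).le
  rw [← mul_assoc, e, one_mul] at b1
  rw [mul_left_comm, mul_left_comm _ (K * s), e, mul_one] at b2
  linarith

/-- The Laplace transform of `f_α(s, ·)`. -/
lemma integral_exp_neg_mul_fFun {α s c : ℝ} (h0 : 0 < α) (h1 : α < 1) (hs : 0 < s)
    (hc : 0 < c) :
    ∫ τ : ℝ, (Real.exp (-(c * τ)) : ℂ) * fFun α c s τ = stretchedExp α s c := by
  set u : ℝ → ℂ := fun y => stretchedExp α s (vline c y) with hu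
  have hui : Integrable u := integrable_stretchedExp_vline h0 h1 hs hc
  have huc : Continuous u := continuous_stretchedExp_vline α s hc
  have hpi : (0 : ℝ) < 2 * Real.pi := by positivity
  have hpi' : (Real.pi : ℂ) ≠ 0 := ofReal_ne_zero.2 Real.pi_pos.ne'
  have hinv : ∀ x : ℝ, 𝓕⁻ u x = 2 * Real.pi *
      ((Real.exp (-(c * (2 * Real.pi * x))) : ℂ) * fFun α c s (2 * Real.pi * x)) := by
    intro x
    have e : (Real.exp (-(c * (2 * Real.pi * x))) : ℂ) * Real.exp (c * (2 * Real.pi * x)) = 1 := by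
      rw [← ofReal_mul, ← Real.exp_add]; simp
    have e2 : 𝓕⁻ u x = ∫ y : ℝ, cexp (I * (2 * Real.pi * x : ℝ) * y) * u y := by
      rw [Real.fourierInv_eq']
      refine integral_congr_ae (ae_of_all _ fun y => ?_)
      simp only [smul_eq_mul, RCLike.inner_apply, conj_trivial]
      congr 2
      push_cast
      ring
    rw [fFun_eq_exp_mul_integral, e2]
    set J := ∫ y : ℝ, cexp (I * (2 * Real.pi * x : ℝ) * y) * u y
    rw [ofReal_mul, ofReal_inv, ofReal_mul, ofReal_ofNat]
    calc J = (Real.exp (-(c * (2 * Real.pi * x))) : ℂ) * Real.exp (c * (2 * Real.pi * x)) * J := by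
          rw [e, one_mul]
      _ = _ := by field_simp
  have hint : Integrable (𝓕⁻ u) := by
    rw [funext hinv]
    exact ((integrable_exp_neg_mul_fFun h0 h1 hs hc).comp_mul_left' hpi.ne').const_mul _
  have hint' : Integrable (𝓕 u) := by
    have : 𝓕 u = fun x => 𝓕⁻ u (-x) := by
      ext x
      rw [Real.fourierInv_eq_fourier_neg, neg_neg]
    rw [this]
    exact hint.comp_neg
  -- Inversion evaluated at height `0`: the Fourier integral there is the plain integral, and `u 0`
  -- is the value at `z = c`.
  have hF := congrFun (huc.fourier_fourierInv_eq hui hint') 0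
  rw [Real.fourier_eq'] at hF
  simp only [inner_zero_right, mul_zero, ofReal_zero, zero_mul, Complex.exp_zero, one_smul,
    hinv, integral_const_mul] at hF
  rw [Measure.integral_comp_mul_left (fun τ : ℝ => (Real.exp (-(c * τ)) : ℂ) * fFun α c s τ),
    abs_of_pos (inv_pos.2 hpi), real_smul, ofReal_inv, ofReal_mul, ofReal_ofNat] at hF
  have : u 0 = stretchedExp α s c := by simp [hu, vline]
  rw [← this, ← hF]
  field_simp

lemma ofReal_norm_fFun {α s c : ℝ} (h0 : 0 < α) (h1 : α < 1) (hs : 0 < s) (hc : 0 < c) (τ : ℝ) :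
    ((‖fFun α c s τ‖ : ℝ) : ℂ) = fFun α c s τ :=
  (eq_coe_norm_of_nonneg (fFun_nonneg h0 h1 hs hc τ)).symm

lemma lintegral_exp_neg_mul_fFun {α s c : ℝ} (h0 : 0 < α) (h1 : α < 1) (hs : 0 < s)
    (hc : 0 < c) :
    ∫⁻ τ in Ioi (0 : ℝ), ENNReal.ofReal (Real.exp (-(c * τ))) * ‖fFun α c s τ‖ₑ =
      ENNReal.ofReal (Real.exp (-(s * c ^ α))) := by
  have hi := integrable_exp_neg_mul_fFun h0 h1 hs hc
  have hnorm : ∀ τ : ℝ, ‖(Real.exp (-(c * τ)) : ℂ) * fFun α c s τ‖ =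
      Real.exp (-(c * τ)) * ‖fFun α c s τ‖ := fun τ => by
    rw [norm_mul, norm_real, Real.norm_of_nonneg (Real.exp_pos _).le]
  have hint : ∫ τ in Ioi (0 : ℝ), ‖(Real.exp (-(c * τ)) : ℂ) * fFun α c s τ‖ =
      Real.exp (-(s * c ^ α)) := by
    -- The closed half-line is used because vanishing has been shown only for `τ < 0`.
    rw [← integral_Ici_eq_integral_Ioi, setIntegral_eq_integral_of_forall_compl_eq_zero]
    · have h := integral_exp_neg_mul_fFun h0 h1 hs hc
      have e : ∀ τ : ℝ, (Real.exp (-(c * τ)) : ℂ) * fFun α c s τ =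
          ((‖(Real.exp (-(c * τ)) : ℂ) * fFun α c s τ‖ : ℝ) : ℂ) := fun τ => by
        rw [hnorm, ofReal_mul, ofReal_norm_fFun h0 h1 hs hc]
      rw [integral_congr_ae (ae_of_all _ e), integral_complex_ofReal, stretchedExp,
        ← ofReal_cpow hc.le] at h
      exact_mod_cast h
    · intro τ hτ
      rw [fFun_of_neg h0 h1 hs hc (by simpa using hτ), mul_zero, norm_zero]
  rw [← hint, ofReal_integral_norm_eq_lintegral_enorm hi.integrableOn]
  refine lintegral_congr fun τ => ?_
  rw [← ofReal_norm, ← ofReal_norm, hnorm, ENNReal.ofReal_mul (Real.exp_pos _).le]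

/-- Monotone convergence along `d n ↓ 0`. Since `f` does not depend on its abscissa, the abscissa
can be moved to `d n` for each `n`, and the Laplace transform at `d n` tends to `1`. -/
lemma lintegral_enorm_fFun {α s c : ℝ} (h0 : 0 < α) (h1 : α < 1) (hs : 0 < s) (hc : 0 < c) :
    ∫⁻ τ in Ioi (0 : ℝ), ‖fFun α c s τ‖ₑ = 1 := by
  set d : ℕ → ℝ := fun n => 1 / ((n : ℝ) + 1) with hd
  have hd0 : ∀ n, 0 < d n := fun n => Nat.one_div_pos_of_nat
  have hdlim : Tendsto d atTop (𝓝 0) := tendsto_one_div_add_atTop_nhds_zero_nat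
  have hdanti : Antitone d := fun m n h => Nat.one_div_le_one_div h
  have hmeas : Measurable fun τ => ‖fFun α c s τ‖ₑ := (continuous_fFun h0 h1 hs hc).measurable.enorm
  have hlim := lintegral_tendsto_of_tendsto_of_monotone
    (μ := volume.restrict (Ioi (0 : ℝ)))
    (f := fun n τ => ENNReal.ofReal (Real.exp (-(d n * τ))) * ‖fFun α c s τ‖ₑ)
    (F := fun τ => ‖fFun α c s τ‖ₑ) (fun n => by fun_prop)
    (by
      filter_upwards [ae_restrict_mem measurableSet_Ioi] with τ hτ m n h
      have hτ0 : 0 < τ := hτ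
      dsimp only
      gcongr
      exact hdanti h)
    (ae_of_all _ fun τ => by
      have h1 : Tendsto (fun n => Real.exp (-(d n * τ))) atTop (𝓝 (Real.exp (-(0 * τ)))) :=
        (Real.continuous_exp.tendsto _).comp (hdlim.mul_const τ).neg
      have h2 := ENNReal.Tendsto.mul_const (b := ‖fFun α c s τ‖ₑ)
        (ENNReal.tendsto_ofReal h1) (Or.inr enorm_ne_top)
      simpa using h2)
  have hval : ∀ n, ∫⁻ τ in Ioi (0 : ℝ), ENNReal.ofReal (Real.exp (-(d n * τ))) * ‖fFun α c s τ‖ₑ =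
      ENNReal.ofReal (Real.exp (-(s * d n ^ α))) := fun n => by
    simp only [fFun_abscissa h0 h1 hs hc (hd0 n)]
    exact lintegral_exp_neg_mul_fFun h0 h1 hs (hd0 n)
  simp only [hval] at hlim
  refine tendsto_nhds_unique hlim ?_
  have h2 : Tendsto (fun n => d n ^ α) atTop (𝓝 0) := by
    simpa [Real.zero_rpow h0.ne'] using hdlim.rpow_const (p := α) (Or.inr h0.le)
  have h3 : Tendsto (fun n => Real.exp (-(s * d n ^ α))) atTop (𝓝 (Real.exp (-(s * 0)))) :=
    (Real.continuous_exp.tendsto _).comp (h2.const_mul s).neg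
  simpa using ENNReal.tendsto_ofReal h3

lemma integrableOn_fFun {α s c : ℝ} (h0 : 0 < α) (h1 : α < 1) (hs : 0 < s) (hc : 0 < c) :
    IntegrableOn (fFun α c s) (Ioi 0) := by
  refine ⟨(continuous_fFun h0 h1 hs hc).aestronglyMeasurable, ?_⟩
  rw [hasFiniteIntegral_iff_enorm, lintegral_enorm_fFun h0 h1 hs hc]
  exact ENNReal.one_lt_top

lemma integral_norm_fFun {α s c : ℝ} (h0 : 0 < α) (h1 : α < 1) (hs : 0 < s) (hc : 0 < c) :
    ∫ τ in Ioi (0 : ℝ), ‖fFun α c s τ‖ = 1 := by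
  rw [integral_norm_eq_lintegral_enorm (integrableOn_fFun h0 h1 hs hc).aestronglyMeasurable,
    lintegral_enorm_fFun h0 h1 hs hc, ENNReal.toReal_one]

lemma integral_fFun {α s c : ℝ} (h0 : 0 < α) (h1 : α < 1) (hs : 0 < s) (hc : 0 < c) :
    ∫ τ in Ioi (0 : ℝ), fFun α c s τ = 1 := by
  rw [← integral_congr_ae (ae_of_all _ (ofReal_norm_fFun h0 h1 hs hc)), integral_complex_ofReal,
    integral_norm_fFun h0 h1 hs hc]
  rfl

/-! ### The density `φ_β` -/

lemma phiFun_eq_fFun {β t σ c : ℝ} (h0 : 0 < β) (h1 : β < 1) (hσ : 0 < σ) (hc : 0 < c) :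
    phiFun β c t σ = ((t / (σ * β) : ℝ) : ℂ) * fFun β c σ t := by
  have h := mul_fFun_eq_phiFun h0 h1 hσ hc t
  have h2 : (σ : ℂ) ≠ 0 := ofReal_ne_zero.2 hσ.ne'
  have h3 : (β : ℂ) ≠ 0 := ofReal_ne_zero.2 h0.ne'
  push_cast
  field_simp
  linear_combination -h

lemma phiFun_nonneg {β t σ c : ℝ} (h0 : 0 < β) (h1 : β < 1) (ht : 0 < t) (hσ : 0 < σ)
    (hc : 0 < c) : 0 ≤ phiFun β c t σ := by
  rw [phiFun_eq_fFun h0 h1 hσ hc]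
  refine mul_nonneg ?_ (fFun_nonneg h0 h1 hσ hc t)
  exact_mod_cast (by positivity : 0 ≤ t / (σ * β))

/-- Shaped for the substitution `u = σ ^ (-1 / β)`, under which `φ_β(t, σ) dσ` becomes `t f_β(1, t
u) du`. -/
lemma phiFun_eq_comp_rpow {β t σ c : ℝ} (h0 : 0 < β) (h1 : β < 1) (hσ : 0 < σ) (hc : 0 < c) :
    phiFun β c t σ = (|-β⁻¹| * σ ^ (-β⁻¹ - 1)) • (fun u => t • fFun β c 1 (t * u)) (σ ^ (-β⁻¹)) := by
  rw [phiFun_eq_fFun h0 h1 hσ hc, fFun_eq_fFun_one h0 h1 hσ hc, abs_neg,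
    abs_of_pos (inv_pos.2 h0), Real.rpow_sub_one hσ.ne']
  simp only [real_smul, mul_comm t (σ ^ (-β⁻¹))]
  push_cast
  field_simp

lemma integrableOn_phiFun {β t c : ℝ} (h0 : 0 < β) (h1 : β < 1) (ht : 0 < t) (hc : 0 < c) :
    IntegrableOn (phiFun β c t) (Ioi 0) := by
  have h : IntegrableOn (fun u => t • fFun β c 1 (t * u)) (Ioi 0) := by
    refine Integrable.smul t ((integrableOn_Ioi_comp_mul_left_iff (fFun β c 1) 0 ht).2 ?_)
    simpa using integrableOn_fFun h0 h1 one_pos hc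
  exact ((integrableOn_Ioi_comp_rpow_iff _ (neg_ne_zero.2 (inv_ne_zero h0.ne'))).2 h).congr_fun
    (fun σ hσ => (phiFun_eq_comp_rpow h0 h1 hσ hc).symm) measurableSet_Ioi

lemma integral_phiFun {β t c : ℝ} (h0 : 0 < β) (h1 : β < 1) (ht : 0 < t) (hc : 0 < c) :
    ∫ σ in Ioi (0 : ℝ), phiFun β c t σ = 1 := by
  rw [setIntegral_congr_fun measurableSet_Ioi fun σ hσ => phiFun_eq_comp_rpow h0 h1 hσ hc,
    integral_comp_rpow_Ioi (fun u => t • fFun β c 1 (t * u)) (neg_ne_zero.2 (inv_ne_zero h0.ne')), integral_smul,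
    integral_comp_mul_left_Ioi' _ _ ht, mul_zero, integral_fFun h0 h1 one_pos hc]

/-! ### The composition `ψ_{α,β}` -/

/-- For `s ≥ 1` the direct bound decreases in `s`, but it blows up as `s → 0`; there the bound
linear in `s` takes over. Boundedness in `s` makes the product with the integrable `φ_β(t, ·)`
integrable. -/
lemma exists_norm_fFun_le {α c τ : ℝ} (h0 : 0 < α) (h1 : α < 1) (hc : 0 < c) (hτ : 0 < τ) :
    ∃ M : ℝ, ∀ s : ℝ, 0 < s → ‖fFun α c s τ‖ ≤ M := by
  obtain ⟨K, hK0, hK⟩ := exists_norm_fFun_le_mul_div_sq h0 h1 hc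
  have hκ := cos_sector_pos h0 h1
  refine ⟨max (K * Real.exp (c * τ) / τ ^ 2) (Real.exp (c * τ) * ((2 * Real.pi)⁻¹ *
      ∫ y : ℝ, Real.exp (-(1 * Real.cos (α * (Real.pi / 2))) * |y| ^ α))), fun s hs => ?_⟩
  rcases le_total s 1 with h | h
  · refine le_max_of_le_left ?_
    rw [le_div_iff₀ (by positivity), mul_comm]
    refine (hK s τ hs).trans ?_
    gcongr
    exact mul_le_of_le_one_right hK0 h
  · refine le_max_of_le_right ((norm_fFun_le h0 h1 hs hc τ).trans ?_)
    refine mul_le_mul_of_nonneg_left (mul_le_mul_of_nonneg_left ?_ (by positivity)) (by positivity)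
    refine integral_mono (integrable_exp_neg_mul_abs_rpow h0 (mul_pos hs hκ))
      (integrable_exp_neg_mul_abs_rpow h0 (mul_pos one_pos hκ)) fun y => ?_
    simp only [neg_mul]
    gcongr

/-- Self-similarity reduces joint measurability to continuity of the single function `f_α(1, ·)`. -/
lemma aestronglyMeasurable_fFun_prod {α c : ℝ} (h0 : 0 < α) (h1 : α < 1) (hc : 0 < c) :
    AEStronglyMeasurable (fun p : ℝ × ℝ => fFun α c p.1 p.2)
      ((volume.restrict (Ioi 0)).prod (volume.restrict (Ioi 0))) := by
  have hm := (continuous_fFun h0 h1 one_pos hc).measurable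
  have h : Measurable fun p : ℝ × ℝ =>
      ((p.1 ^ (-α⁻¹) : ℝ) : ℂ) * fFun α c 1 (p.1 ^ (-α⁻¹) * p.2) := by fun_prop
  refine h.aestronglyMeasurable.congr ?_
  rw [Measure.prod_restrict]
  filter_upwards [ae_restrict_mem (measurableSet_Ioi.prod measurableSet_Ioi)] with p hp
  exact (fFun_eq_fFun_one h0 h1 hp.1 hc p.2).symm

lemma integrableOn_phiFun_mul_fFun {α β a b t τ : ℝ} (hα0 : 0 < α) (hα1 : α < 1) (hβ0 : 0 < β)
    (hβ1 : β < 1) (ha : 0 < a) (hb : 0 < b) (ht : 0 < t) (hτ : 0 < τ) :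
    IntegrableOn (fun s => phiFun β b t s * fFun α a s τ) (Ioi 0) := by
  obtain ⟨M, hM⟩ := exists_norm_fFun_le hα0 hα1 ha hτ
  have hm : AEStronglyMeasurable (fun s => fFun α a s τ) (volume.restrict (Ioi 0)) := by
    have hm := (continuous_fFun hα0 hα1 one_pos ha).measurable
    have h : Measurable fun s : ℝ =>
      ((s ^ (-α⁻¹) : ℝ) : ℂ) * fFun α a 1 (s ^ (-α⁻¹) * τ) := by fun_prop
    refine h.aestronglyMeasurable.congr ?_
    filter_upwards [ae_restrict_mem measurableSet_Ioi] with s hs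
    exact (fFun_eq_fFun_one hα0 hα1 hs ha τ).symm
  refine Integrable.mul_bdd (c := M) (integrableOn_phiFun hβ0 hβ1 ht hb) hm ?_
  filter_upwards [ae_restrict_mem measurableSet_Ioi] with s hs
  exact hM s hs

lemma integrable_phiFun_mul_fFun_prod {α β a b t : ℝ} (hα0 : 0 < α) (hα1 : α < 1) (hβ0 : 0 < β)
    (hβ1 : β < 1) (ha : 0 < a) (hb : 0 < b) (ht : 0 < t) :
    Integrable (Function.uncurry fun s τ : ℝ => phiFun β b t s * fFun α a s τ)
      ((volume.restrict (Ioi 0)).prod (volume.restrict (Ioi 0))) := by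
  have hφ := integrableOn_phiFun hβ0 hβ1 ht hb
  refine (integrable_prod_iff (hφ.aestronglyMeasurable.comp_fst.mul
    (aestronglyMeasurable_fFun_prod hα0 hα1 ha))).2 ?_
  constructor
  · filter_upwards [ae_restrict_mem measurableSet_Ioi] with s hs
    exact (integrableOn_fFun hα0 hα1 hs ha).const_mul (phiFun β b t s)
  -- Each `f_α(s, ·)` has norm integral `1`, so integrating out `τ` leaves `‖φ_β(t, s)‖`.
  · refine hφ.norm.congr ?_
    filter_upwards [ae_restrict_mem measurableSet_Ioi] with s hs
    simp only [Pi.mul_apply, norm_mul, integral_const_mul, integral_norm_fFun hα0 hα1 hs ha,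
      mul_one]

lemma integral_integral_phiFun_mul_fFun {α β a b t : ℝ} (hα0 : 0 < α) (hα1 : α < 1)
    (hβ0 : 0 < β) (hβ1 : β < 1) (ha : 0 < a) (hb : 0 < b) (ht : 0 < t) :
    ∫ τ in Ioi (0 : ℝ), ∫ s in Ioi (0 : ℝ), phiFun β b t s * fFun α a s τ = 1 := by
  rw [← integral_integral_swap (integrable_phiFun_mul_fFun_prod hα0 hα1 hβ0 hβ1 ha hb ht),
    ← integral_phiFun hβ0 hβ1 ht hb]
  refine setIntegral_congr_fun measurableSet_Ioi fun s hs => ?_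
  simp only [integral_const_mul, integral_fFun hα0 hα1 hs ha, mul_one]

lemma integral_phiFun_mul_fFun_nonneg {α β a b t : ℝ} (hα0 : 0 < α) (hα1 : α < 1)
    (hβ0 : 0 < β) (hβ1 : β < 1) (ha : 0 < a) (hb : 0 < b) (ht : 0 < t) (τ : ℝ) :
    0 ≤ ∫ s in Ioi (0 : ℝ), phiFun β b t s * fFun α a s τ := by
  have e : ∀ s ∈ Ioi (0 : ℝ), phiFun β b t s * fFun α a s τ =
      ((‖phiFun β b t s * fFun α a s τ‖ : ℝ) : ℂ) := fun s hs =>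
    eq_coe_norm_of_nonneg (mul_nonneg (phiFun_nonneg hβ0 hβ1 ht hs hb)
      (fFun_nonneg hα0 hα1 hs ha τ))
  rw [setIntegral_congr_fun measurableSet_Ioi e, integral_complex_ofReal]
  exact_mod_cast integral_nonneg fun s => norm_nonneg _

lemma isUnilateralPdf_density {k : ℝ → ℝ → ℂ} {t : ℝ} (h : ∀ τ : ℝ, 0 < τ → 0 ≤ k t τ)
    (hi : IntegrableOn (k t) (Ioi 0)) (h1 : ∫ τ in Ioi (0 : ℝ), k t τ = 1) :
    (SubKernel.density k).IsUnilateralPdf t :=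
  ⟨fun τ hτ => ⟨(Complex.nonneg_iff.1 (h τ hτ)).2.symm, (Complex.nonneg_iff.1 (h τ hτ)).1⟩, hi, h1⟩

theorem proposition2p2 (α β : ℝ) (hα0 : 0 < α) (hα1 : α ≤ 1) (hβ0 : 0 < β) (hβ1 : β ≤ 1)
    (a b : ℝ) (ha : 0 < a) (hb : 0 < b) (t : ℝ) (ht : 0 < t) :
    -- the integrals that define the kernels converge absolutely
    (α < 1 → ∀ s τ : ℝ, 0 < s → 0 < τ → Integrable (verticalIntegrand a (fIntegrand α s τ))) ∧
    (β < 1 → ∀ s τ : ℝ, 0 < s → 0 < τ → Integrable (verticalIntegrand b (phiIntegrand β s τ))) ∧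
    (α < 1 → β < 1 → ∀ τ : ℝ, 0 < τ →
      IntegrableOn (fun s : ℝ => phiFun β b t s * fFun α a s τ) (Set.Ioi 0)) ∧
    -- the kernel is a unilateral probability density in its second variable
    (psiKernel α β a b).IsUnilateralPdf t := by
  refine ⟨fun h s τ hs _ => integrable_verticalIntegrand_fIntegrand hα0 h hs ha,
    fun h s τ _ hτ => integrable_verticalIntegrand_phiIntegrand hβ0 h hτ hb,
    fun h h' τ hτ => integrableOn_phiFun_mul_fFun hα0 h hβ0 h' ha hb ht hτ, ?_⟩
  unfold psiKernel phiKernel fKernel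
  rcases hβ1.eq_or_lt with hβ | hβ <;> rcases hα1.eq_or_lt with hα | hα
  · rw [if_pos hβ, if_pos hα]
    simp [SubKernel.comp, SubKernel.IsUnilateralPdf, ht]
  · rw [if_pos hβ, if_neg hα.ne]
    exact isUnilateralPdf_density (fun τ _ => fFun_nonneg hα0 hα ht ha τ)
      (integrableOn_fFun hα0 hα ht ha) (integral_fFun hα0 hα ht ha)
  · rw [if_neg hβ.ne, if_pos hα]
    exact isUnilateralPdf_density (fun τ hτ => phiFun_nonneg hβ0 hβ ht hτ hb)
      (integrableOn_phiFun hβ0 hβ ht hb) (integral_phiFun hβ0 hβ ht hb)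
  · rw [if_neg hβ.ne, if_neg hα.ne]
    exact isUnilateralPdf_density
      (fun τ _ => integral_phiFun_mul_fFun_nonneg hα0 hα hβ0 hβ ha hb ht τ)
      (integrable_phiFun_mul_fFun_prod hα0 hα hβ0 hβ ha hb ht).integral_prod_right
      (integral_integral_phiFun_mul_fFun hα0 hα hβ0 hβ ha hb ht)
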